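/- Let $\mathbb K$ be $\mathbb R$ or $\mathbb C$. For a Banach algebra $B$ over $\mathbb K$ (not necessarily unital), $\mu\in B'$, $a,b\in B$ and $\Phi,\Psi\in B''$, define $a\cdot\mu,\ \mu\cdot a,\ \Phi\cdot\mu,\ \mu\cdot\Phi\in B'$ by $\langle a\cdot\mu,b\rangle=\langle\mu,ba\rangle$, $\langle\mu\cdot a,b\rangle=\langle\mu,ab\rangle$, $\langle\Phi\cdot\mu,a\rangle=\langle\Phi,\mu\cdot a\rangle$, $\langle\mu\cdot\Phi,a\rangle=\langle\Phi,a\cdot\mu\rangle$, and the first and second Arens products on $B''$ by $\langle\Phi\Box\Psi,\mu\rangle=\langle\Phi,\Psi\cdot\mu\rangle$ and $\langle\Phi\Diamond\Psi,\mu\rangle=\langle\Psi,\mu\cdot\Phi\rangle$. The algebra $B$ is Arens regular if $\Box=\Diamond$ on $B''$. Let $\operatorname{WAP}(B')$ be the set of $\mu\in B'$ such that $B\to B'$, $a\mapsto a\cdot\mu$, is weakly compact. For an ultrafilter $\mathcal U$ on a set $I$ and a Banach space $E$, the ultrapower is $(E)_{\mathcal U}=\ell^\infty(E,I)/\{(x_i):\lim_{i\to\mathcal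 U}\|x_i\|=0\}$; if $E$ is a Banach algebra, so is $(E)_{\mathcal U}$, with the pointwise product. Let $(A,A_*)$ be a dual Banach algebra; that is, $A_*$ is a Banach space and $A$ is a Banach algebra with $A=A_*'$ isometrically, whose product is separately weak$^*$-continuous. Via $\langle(\mu_i),(a_i)\rangle=\lim_{i\to\mathcal U}\langle a_i,\mu_i\rangle$, regard $(A_*)_{\mathcal U}$ as a subspace of $(A)_{\mathcal U}'$. Suppose that for every non-principal ultrafilter $\mathcal U$ on any set, $$(A_*)_{\mathcal U}\subseteq\operatorname{WAP}\big((A)_{\mathcal U}'\big).$$ Then $A$ and every even dual $A'',A'''',\dots$ of $A$ are Arens regular, where each even dual carries the first Arens product coming from the preceding one (which, by the regularity of the preceding algebra, equals the second Arens product). -/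

import Mathlib

open Filter Topology
open scoped ENNReal

universe u v

noncomputable section

/-! ## Arens products, Arens regularity, weakly almost periodic functionals

A Banach algebra over `𝕜` (not necessarily unital) is a complete `NonUnitalNormedRing A` with
`[NormedSpace 𝕜 A] [IsScalarTower 𝕜 A A] [SMulCommClass 𝕜 A A]`. -/

section Arens

variable (𝕜 : Type) [RCLike 𝕜] (A : Type u) [NonUnitalNormedRing A] [NormedSpace 𝕜 A]
  [IsScalarTower 𝕜 A A] [SMulCommClass 𝕜 A A]

/-- The right module action: `dualRight 𝕜 A μ a = μ · a`, where `⟨μ · a, b⟩ = ⟨μ, a b⟩`. -/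
def dualRight : StrongDual 𝕜 A →L[𝕜] A →L[𝕜] StrongDual 𝕜 A :=
  ((ContinuousLinearMap.compL 𝕜 A (A →L[𝕜] A) (StrongDual 𝕜 A)).flip
    (ContinuousLinearMap.mul 𝕜 A)).comp (ContinuousLinearMap.compL 𝕜 A A 𝕜)

/-- The left module action: `dualLeft 𝕜 A μ a = a · μ`, where `⟨a · μ, b⟩ = ⟨μ, b a⟩`. Thus
`dualLeft 𝕜 A μ` is the map `L_μ : A → A'`, `a ↦ a · μ`. -/
def dualLeft : StrongDual 𝕜 A →L[𝕜] A →L[𝕜] StrongDual 𝕜 A :=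
  ((ContinuousLinearMap.compL 𝕜 A (A →L[𝕜] A) (StrongDual 𝕜 A)).flip
    (ContinuousLinearMap.mul 𝕜 A).flip).comp (ContinuousLinearMap.compL 𝕜 A A 𝕜)

/-- `bidualLeft 𝕜 A Φ μ = Φ · μ`, where `⟨Φ · μ, a⟩ = ⟨Φ, μ · a⟩`. -/
def bidualLeft (Φ : StrongDual 𝕜 (StrongDual 𝕜 A)) : StrongDual 𝕜 A →L[𝕜] StrongDual 𝕜 A :=
  (ContinuousLinearMap.compL 𝕜 A (StrongDual 𝕜 A) 𝕜 Φ).comp (dualRight 𝕜 A)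

/-- `bidualRight 𝕜 A Φ μ = μ · Φ`, where `⟨μ · Φ, a⟩ = ⟨Φ, a · μ⟩`. -/
def bidualRight (Φ : StrongDual 𝕜 (StrongDual 𝕜 A)) : StrongDual 𝕜 A →L[𝕜] StrongDual 𝕜 A :=
  (ContinuousLinearMap.compL 𝕜 A (StrongDual 𝕜 A) 𝕜 Φ).comp (dualLeft 𝕜 A)

/-- The first Arens product: `⟨Φ □ Ψ, μ⟩ = ⟨Φ, Ψ · μ⟩`. -/
def arensFirst (Φ Ψ : StrongDual 𝕜 (StrongDual 𝕜 A)) : StrongDual 𝕜 (StrongDual 𝕜 A) :=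
  Φ.comp (bidualLeft 𝕜 A Ψ)

/-- The second Arens product: `⟨Φ ◇ Ψ, μ⟩ = ⟨Ψ, μ · Φ⟩`. -/
def arensSecond (Φ Ψ : StrongDual 𝕜 (StrongDual 𝕜 A)) : StrongDual 𝕜 (StrongDual 𝕜 A) :=
  Ψ.comp (bidualRight 𝕜 A Φ)

variable {A}

theorem dualRight_apply (μ : StrongDual 𝕜 A) (a b : A) : dualRight 𝕜 A μ a b = μ (a * b) := rfl

theorem dualLeft_apply (μ : StrongDual 𝕜 A) (a b : A) : dualLeft 𝕜 A μ a b = μ (b * a) := rfl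

theorem bidualLeft_apply (Φ : StrongDual 𝕜 (StrongDual 𝕜 A)) (μ : StrongDual 𝕜 A) (a : A) :
    bidualLeft 𝕜 A Φ μ a = Φ (dualRight 𝕜 A μ a) := rfl

theorem bidualRight_apply (Φ : StrongDual 𝕜 (StrongDual 𝕜 A)) (μ : StrongDual 𝕜 A) (a : A) :
    bidualRight 𝕜 A Φ μ a = Φ (dualLeft 𝕜 A μ a) := rfl

theorem arensFirst_apply (Φ Ψ : StrongDual 𝕜 (StrongDual 𝕜 A)) (μ : StrongDual 𝕜 A) :
    arensFirst 𝕜 A Φ Ψ μ = Φ (bidualLeft 𝕜 A Ψ μ) := rfl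

theorem arensSecond_apply (Φ Ψ : StrongDual 𝕜 (StrongDual 𝕜 A)) (μ : StrongDual 𝕜 A) :
    arensSecond 𝕜 A Φ Ψ μ = Ψ (bidualRight 𝕜 A Φ μ) := rfl

theorem norm_dualRight_le (μ : StrongDual 𝕜 A) (a : A) : ‖dualRight 𝕜 A μ a‖ ≤ ‖μ‖ * ‖a‖ := by
  refine ContinuousLinearMap.opNorm_le_bound _ (by positivity) fun b => ?_
  calc ‖μ (a * b)‖ ≤ ‖μ‖ * ‖a * b‖ := μ.le_opNorm _
    _ ≤ ‖μ‖ * (‖a‖ * ‖b‖) := by gcongr; exact norm_mul_le a b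
    _ = ‖μ‖ * ‖a‖ * ‖b‖ := by ring

theorem norm_bidualLeft_le (Φ : StrongDual 𝕜 (StrongDual 𝕜 A)) (μ : StrongDual 𝕜 A) :
    ‖bidualLeft 𝕜 A Φ μ‖ ≤ ‖Φ‖ * ‖μ‖ := by
  refine ContinuousLinearMap.opNorm_le_bound _ (by positivity) fun a => ?_
  calc ‖Φ (dualRight 𝕜 A μ a)‖ ≤ ‖Φ‖ * ‖dualRight 𝕜 A μ a‖ := Φ.le_opNorm _
    _ ≤ ‖Φ‖ * (‖μ‖ * ‖a‖) := by gcongr; exact norm_dualRight_le 𝕜 μ a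
    _ = ‖Φ‖ * ‖μ‖ * ‖a‖ := by ring

theorem norm_arensFirst_le (Φ Ψ : StrongDual 𝕜 (StrongDual 𝕜 A)) :
    ‖arensFirst 𝕜 A Φ Ψ‖ ≤ ‖Φ‖ * ‖Ψ‖ := by
  refine ContinuousLinearMap.opNorm_le_bound _ (by positivity) fun μ => ?_
  calc ‖Φ (bidualLeft 𝕜 A Ψ μ)‖ ≤ ‖Φ‖ * ‖bidualLeft 𝕜 A Ψ μ‖ := Φ.le_opNorm _
    _ ≤ ‖Φ‖ * (‖Ψ‖ * ‖μ‖) := by gcongr; exact norm_bidualLeft_le 𝕜 Ψ μ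
    _ = ‖Φ‖ * ‖Ψ‖ * ‖μ‖ := by ring

theorem arensFirst_assoc (Φ Ψ Θ : StrongDual 𝕜 (StrongDual 𝕜 A)) :
    arensFirst 𝕜 A (arensFirst 𝕜 A Φ Ψ) Θ = arensFirst 𝕜 A Φ (arensFirst 𝕜 A Ψ Θ) := by
  have h (μ : StrongDual 𝕜 A) (a : A) :
      bidualLeft 𝕜 A Θ (dualRight 𝕜 A μ a) = dualRight 𝕜 A (bidualLeft 𝕜 A Θ μ) a := by
    refine ContinuousLinearMap.ext fun b => ?_
    rw [dualRight_apply, bidualLeft_apply, bidualLeft_apply]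
    refine congrArg Θ (ContinuousLinearMap.ext fun c => ?_)
    simp only [dualRight_apply, mul_assoc]
  refine ContinuousLinearMap.ext fun μ => ?_
  rw [arensFirst_apply, arensFirst_apply, arensFirst_apply]
  refine congrArg Φ (ContinuousLinearMap.ext fun a => ?_)
  rw [bidualLeft_apply, bidualLeft_apply, arensFirst_apply, h]

variable (A)

/-- `A` is Arens regular when the two Arens products agree on all of `A''`. -/
def ArensRegular : Prop :=
  ∀ Φ Ψ : StrongDual 𝕜 (StrongDual 𝕜 A), arensFirst 𝕜 A Φ Ψ = arensSecond 𝕜 A Φ Ψ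

/-- A bounded operator is weakly compact when it sends the closed unit ball to a relatively
weakly compact set. -/
def IsWeaklyCompactOperator {𝕜 : Type} [RCLike 𝕜] {E : Type u} {F : Type v}
    [NormedAddCommGroup E] [NormedSpace 𝕜 E] [NormedAddCommGroup F] [NormedSpace 𝕜 F]
    (T : E →L[𝕜] F) : Prop :=
  IsCompact (closure ((fun x => toWeakSpace 𝕜 F (T x)) '' Metric.closedBall (0 : E) 1))

/-- `WAP(A')`: the functionals `μ` for which `L_μ : A → A'`, `a ↦ a · μ`, is weakly compact. -/
def WAP : Set (StrongDual 𝕜 A) :=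
  {μ | IsWeaklyCompactOperator (dualLeft 𝕜 A μ)}

end Arens

/-! ## The bidual as a Banach algebra, and the even duals -/

/-- The bidual `A''`, a Banach algebra under the first Arens product. -/
def Bidual (𝕜 : Type) [RCLike 𝕜] (A : Type u) [NonUnitalNormedRing A] [NormedSpace 𝕜 A] : Type u :=
  StrongDual 𝕜 (StrongDual 𝕜 A)

namespace Bidual

section Normed

variable (𝕜 : Type) [RCLike 𝕜] (A : Type u) [NonUnitalNormedRing A] [NormedSpace 𝕜 A]

instance : NormedAddCommGroup (Bidual 𝕜 A) :=
  inferInstanceAs (NormedAddCommGroup (StrongDual 𝕜 (StrongDual 𝕜 A)))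

instance : NormedSpace 𝕜 (Bidual 𝕜 A) :=
  inferInstanceAs (NormedSpace 𝕜 (StrongDual 𝕜 (StrongDual 𝕜 A)))

end Normed

variable (𝕜 : Type) [RCLike 𝕜] (A : Type u) [NonUnitalNormedRing A] [NormedSpace 𝕜 A]
  [IsScalarTower 𝕜 A A] [SMulCommClass 𝕜 A A]

instance : Mul (Bidual 𝕜 A) := ⟨fun Φ Ψ => arensFirst 𝕜 A Φ Ψ⟩

theorem mul_def (Φ Ψ : Bidual 𝕜 A) : Φ * Ψ = arensFirst 𝕜 A Φ Ψ := rfl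

theorem mul_apply (Φ Ψ : StrongDual 𝕜 (StrongDual 𝕜 A)) (μ : StrongDual 𝕜 A) :
    (show StrongDual 𝕜 (StrongDual 𝕜 A) from (show Bidual 𝕜 A from Φ) * (show Bidual 𝕜 A from Ψ)) μ
      = Φ (bidualLeft 𝕜 A Ψ μ) := rfl

instance instNonUnitalNormedRing : NonUnitalNormedRing (Bidual 𝕜 A) :=
  { (inferInstance : NormedAddCommGroup (Bidual 𝕜 A)), (inferInstance : Mul (Bidual 𝕜 A)) with
    left_distrib := fun Φ Ψ Θ => by
      refine ContinuousLinearMap.ext fun μ => ?_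
      exact map_add (show StrongDual 𝕜 (StrongDual 𝕜 A) from Φ) (bidualLeft 𝕜 A Ψ μ)
        (bidualLeft 𝕜 A Θ μ)
    right_distrib := fun _ _ _ => rfl
    zero_mul := fun _ => rfl
    mul_zero := fun Φ => by
      refine ContinuousLinearMap.ext fun μ => ?_
      exact map_zero (show StrongDual 𝕜 (StrongDual 𝕜 A) from Φ)
    mul_assoc := fun Φ Ψ Θ => arensFirst_assoc 𝕜 Φ Ψ Θ
    norm_mul_le := fun Φ Ψ => norm_arensFirst_le 𝕜 Φ Ψ }

instance : IsScalarTower 𝕜 (Bidual 𝕜 A) (Bidual 𝕜 A) := ⟨fun _ _ _ => rfl⟩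

instance : SMulCommClass 𝕜 (Bidual 𝕜 A) (Bidual 𝕜 A) := ⟨fun c Φ Ψ => by
  refine ContinuousLinearMap.ext fun μ => ?_
  exact (map_smul (show StrongDual 𝕜 (StrongDual 𝕜 A) from Φ) c (bidualLeft 𝕜 A Ψ μ)).symm⟩

instance : CompleteSpace (Bidual 𝕜 A) :=
  inferInstanceAs (CompleteSpace (StrongDual 𝕜 (StrongDual 𝕜 A)))

end Bidual

/-- Bundled Banach algebras over `𝕜`, used to iterate the bidual. -/
structure BanachAlg (𝕜 : Type) [RCLike 𝕜] : Type (u + 1) where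
  carrier : Type u
  [ring : NonUnitalNormedRing carrier]
  [normedSpace : NormedSpace 𝕜 carrier]
  [isScalarTower : IsScalarTower 𝕜 carrier carrier]
  [smulCommClass : SMulCommClass 𝕜 carrier carrier]
  [complete : CompleteSpace carrier]

attribute [instance] BanachAlg.ring BanachAlg.normedSpace BanachAlg.isScalarTower
  BanachAlg.smulCommClass BanachAlg.complete

/-- The bidual of a bundled Banach algebra, with the first Arens product. -/
def BanachAlg.bidual {𝕜 : Type} [RCLike 𝕜] (A : BanachAlg.{u} 𝕜) : BanachAlg.{u} 𝕜 where
  carrier := Bidual 𝕜 A.carrier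

/-- The `2n`-th dual of `A`: `A, A'', A'''', …`, each with the first Arens product coming from the
preceding one. -/
def evenDual {𝕜 : Type} [RCLike 𝕜] (A : BanachAlg.{u} 𝕜) : ℕ → BanachAlg.{u} 𝕜
  | 0 => A
  | n + 1 => (evenDual A n).bidual

/-! ## Ultrapowers -/

section Ultrapower

variable (𝕜 : Type) [RCLike 𝕜] {I : Type v} (U : Ultrafilter I)

/-- The subspace of `ℓ^∞(E, I)` of families with `lim_{i → U} ‖x i‖ = 0`. -/
def nullFamilies (E : Type u) [NormedAddCommGroup E] [NormedSpace 𝕜 E] :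
    Submodule 𝕜 (lp (fun _ : I => E) ∞) where
  carrier := {x | Tendsto (fun i => x i) (U : Filter I) (𝓝 0)}
  add_mem' := fun {x y} hx hy => by
    simpa using Tendsto.add (f := fun i => x i) (g := fun i => y i) hx hy
  zero_mem' := by
    simp
  smul_mem' := fun c x hx => by
    simpa using Tendsto.const_smul (f := fun i => x i) hx c

theorem mem_nullFamilies {E : Type u} [NormedAddCommGroup E] [NormedSpace 𝕜 E]
    (x : lp (fun _ : I => E) ∞) :
    x ∈ nullFamilies 𝕜 U E ↔ Tendsto (fun i => ‖x i‖) (U : Filter I) (𝓝 0) :=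
  tendsto_zero_iff_norm_tendsto_zero

instance isClosed_nullFamilies (E : Type u) [NormedAddCommGroup E] [NormedSpace 𝕜 E] :
    IsClosed (nullFamilies 𝕜 U E : Set (lp (fun _ : I => E) ∞)) := by
  refine isClosed_of_closure_subset fun x hx => ?_
  rw [SetLike.mem_coe, mem_nullFamilies, Metric.tendsto_nhds]
  intro ε hε
  obtain ⟨y, hy, hxy⟩ := Metric.mem_closure_iff.1 hx (ε / 2) (by positivity)
  rw [SetLike.mem_coe, mem_nullFamilies, Metric.tendsto_nhds] at hy
  filter_upwards [hy (ε / 2) (by positivity)] with i hi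
  have h1 : ‖x i - y i‖ ≤ ‖x - y‖ := lp.norm_apply_le_norm ENNReal.top_ne_zero (x - y) i
  rw [dist_eq_norm] at hxy
  simp only [dist_zero_right, norm_norm] at hi ⊢
  have h2 : ‖x i‖ ≤ ‖x i - y i‖ + ‖y i‖ := by simpa using norm_add_le (x i - y i) (y i)
  linarith

/-- The ultrapower `(E)_U = ℓ^∞(E, I) / N_U`, with the quotient norm. -/
def Ultrapower (E : Type u) [NormedAddCommGroup E] [NormedSpace 𝕜 E] : Type (max u v) :=
  lp (fun _ : I => E) ∞ ⧸ nullFamilies 𝕜 U E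

namespace Ultrapower

section Normed

variable (E : Type u) [NormedAddCommGroup E] [NormedSpace 𝕜 E]

instance : NormedAddCommGroup (Ultrapower 𝕜 U E) :=
  inferInstanceAs (NormedAddCommGroup (lp (fun _ : I => E) ∞ ⧸ nullFamilies 𝕜 U E))

instance : NormedSpace 𝕜 (Ultrapower 𝕜 U E) :=
  inferInstanceAs (NormedSpace 𝕜 (lp (fun _ : I => E) ∞ ⧸ nullFamilies 𝕜 U E))

instance [CompleteSpace E] : CompleteSpace (Ultrapower 𝕜 U E) :=
  inferInstanceAs (CompleteSpace (lp (fun _ : I => E) ∞ ⧸ nullFamilies 𝕜 U E))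

variable {E}

/-- The class in `(E)_U` of a bounded family. -/
def mk (x : lp (fun _ : I => E) ∞) : Ultrapower 𝕜 U E := Submodule.Quotient.mk x

end Normed

section Mul

variable (A : Type u) [NonUnitalNormedRing A] [NormedSpace 𝕜 A]

/-- The pointwise product. -/
instance : Mul (Ultrapower 𝕜 U A) where
  mul := Quotient.map₂ (· * ·) fun x x' hx y y' hy => by
    replace hx := (Submodule.quotientRel_def _).1 hx
    replace hy := (Submodule.quotientRel_def _).1 hy
    refine (Submodule.quotientRel_def _).2 ?_
    have key : x * y - x' * y' = (x - x') * y + x' * (y - y') := by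
      rw [sub_mul, mul_sub]; abel
    rw [key, mem_nullFamilies]
    rw [mem_nullFamilies] at hx hy
    have hlim : Tendsto (fun i => ‖(x - x') i‖ * ‖y‖ + ‖x'‖ * ‖(y - y') i‖) (U : Filter I)
        (𝓝 0) := by
      simpa using (hx.mul_const ‖y‖).add (hy.const_mul ‖x'‖)
    refine squeeze_zero (fun i => norm_nonneg _) (fun i => ?_) hlim
    have hy' : ‖y i‖ ≤ ‖y‖ := lp.norm_apply_le_norm ENNReal.top_ne_zero y i
    have hx' : ‖x' i‖ ≤ ‖x'‖ := lp.norm_apply_le_norm ENNReal.top_ne_zero x' i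
    calc ‖((x - x') * y + x' * (y - y')) i‖ = ‖(x - x') i * y i + x' i * (y - y') i‖ := rfl
      _ ≤ ‖(x - x') i‖ * ‖y i‖ + ‖x' i‖ * ‖(y - y') i‖ :=
        (norm_add_le _ _).trans (add_le_add (norm_mul_le _ _) (norm_mul_le _ _))
      _ ≤ ‖(x - x') i‖ * ‖y‖ + ‖x'‖ * ‖(y - y') i‖ := by gcongr

variable {A} in
theorem mk_mul (x y : lp (fun _ : I => A) ∞) : mk 𝕜 U (x * y) = mk 𝕜 U x * mk 𝕜 U y := rfl

instance instNonUnitalNormedRing : NonUnitalNormedRing (Ultrapower 𝕜 U A) :=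
  { (inferInstance : NormedAddCommGroup (Ultrapower 𝕜 U A)),
    (inferInstance : Mul (Ultrapower 𝕜 U A)) with
    left_distrib := by
      rintro ⟨x⟩ ⟨y⟩ ⟨z⟩; exact congrArg (mk 𝕜 U) (mul_add x y z)
    right_distrib := by
      rintro ⟨x⟩ ⟨y⟩ ⟨z⟩; exact congrArg (mk 𝕜 U) (add_mul x y z)
    zero_mul := by
      rintro ⟨x⟩; exact congrArg (mk 𝕜 U) (zero_mul x)
    mul_zero := by
      rintro ⟨x⟩; exact congrArg (mk 𝕜 U) (mul_zero x)
    mul_assoc := by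
      rintro ⟨x⟩ ⟨y⟩ ⟨z⟩; exact congrArg (mk 𝕜 U) (mul_assoc x y z)
    norm_mul_le := fun a b => by
      have hlim : Tendsto (fun ε : ℝ => (‖a‖ + ε) * (‖b‖ + ε)) (𝓝[>] 0) (𝓝 (‖a‖ * ‖b‖)) := by
        have hc : Continuous fun ε : ℝ => (‖a‖ + ε) * (‖b‖ + ε) := by fun_prop
        simpa using (hc.tendsto 0).mono_left nhdsWithin_le_nhds
      refine ge_of_tendsto hlim ?_
      filter_upwards [self_mem_nhdsWithin] with ε hε
      obtain ⟨x, rfl, hx⟩ := Submodule.Quotient.norm_mk_lt (S := nullFamilies 𝕜 U A) a hε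
      obtain ⟨y, rfl, hy⟩ := Submodule.Quotient.norm_mk_lt (S := nullFamilies 𝕜 U A) b hε
      exact (Submodule.Quotient.norm_mk_le _ (x * y)).trans
        ((norm_mul_le x y).trans (mul_le_mul hx.le hy.le (norm_nonneg _)
          ((norm_nonneg _).trans hx.le))) }

instance [IsScalarTower 𝕜 A A] : IsScalarTower 𝕜 (Ultrapower 𝕜 U A) (Ultrapower 𝕜 U A) :=
  ⟨by rintro c ⟨x⟩ ⟨y⟩; exact congrArg (mk 𝕜 U) (smul_mul_assoc c x y)⟩

instance [SMulCommClass 𝕜 A A] : SMulCommClass 𝕜 (Ultrapower 𝕜 U A) (Ultrapower 𝕜 U A) :=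
  ⟨by rintro c ⟨x⟩ ⟨y⟩; exact congrArg (mk 𝕜 U) (mul_smul_comm c x y).symm⟩

end Mul

end Ultrapower

end Ultrapower

/-! ## Dual Banach algebras and the canonical map `(A_*)_U → (A)_U'` -/

section DualBanachAlgebra

variable {𝕜 : Type} [RCLike 𝕜] {X : Type u} [NormedAddCommGroup X] [NormedSpace 𝕜 X]

/-- The weak-star topology which an identification `A = X'` puts on `A`. -/
abbrev weakStarTopology {A : Type u} [NormedAddCommGroup A] [NormedSpace 𝕜 A]
    (e : A ≃ₗᵢ[𝕜] StrongDual 𝕜 X) : TopologicalSpace A :=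
  TopologicalSpace.induced (fun a => StrongDual.toWeakDual (e a)) inferInstance

/-- `(A, X)` is a dual Banach algebra: `A` is identified with the dual `X'` by `e`, and the product
of `A` is separately weak-star continuous. -/
structure IsDualBanachAlgebra {A : Type u} [NonUnitalNormedRing A] [NormedSpace 𝕜 A]
    (e : A ≃ₗᵢ[𝕜] StrongDual 𝕜 X) : Prop where
  continuous_mul_left : ∀ a : A,
    Continuous[weakStarTopology e, weakStarTopology e] fun b : A => a * b
  continuous_mul_right : ∀ a : A,
    Continuous[weakStarTopology e, weakStarTopology e] fun b : A => b * a

variable {A : Type u} [NormedAddCommGroup A] [NormedSpace 𝕜 A] (e : A ≃ₗᵢ[𝕜] StrongDual 𝕜 X)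
  {I : Type v} (U : Ultrafilter I)

theorem norm_pairing_le (μ : lp (fun _ : I => X) ∞) (a : lp (fun _ : I => A) ∞) (i : I) :
    ‖e (a i) (μ i)‖ ≤ ‖μ‖ * ‖a‖ := by
  have h1 : ‖μ i‖ ≤ ‖μ‖ := lp.norm_apply_le_norm ENNReal.top_ne_zero μ i
  have h2 : ‖a i‖ ≤ ‖a‖ := lp.norm_apply_le_norm ENNReal.top_ne_zero a i
  calc ‖e (a i) (μ i)‖ ≤ ‖e (a i)‖ * ‖μ i‖ := (e (a i)).le_opNorm _
    _ = ‖μ i‖ * ‖a i‖ := by rw [e.norm_map, mul_comm]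
    _ ≤ ‖μ‖ * ‖a‖ := by gcongr

/-- `lim_{i → U} ⟨a i, μ i⟩`. -/
def limPairing (μ : lp (fun _ : I => X) ∞) (a : lp (fun _ : I => A) ∞) : 𝕜 :=
  limUnder (U : Filter I) fun i => e (a i) (μ i)

theorem tendsto_limPairing (μ : lp (fun _ : I => X) ∞) (a : lp (fun _ : I => A) ∞) :
    Tendsto (fun i => e (a i) (μ i)) (U : Filter I) (𝓝 (limPairing e U μ a)) := by
  obtain ⟨z, -, hz⟩ := (isCompact_closedBall (0 : 𝕜) (‖μ‖ * ‖a‖)).ultrafilter_le_nhds'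
    (U.map fun i => e (a i) (μ i)) (Filter.mem_map.2 (Filter.univ_mem' fun i => by
      simpa using norm_pairing_le e μ a i))
  exact tendsto_nhds_limUnder ⟨z, hz⟩

theorem limPairing_eq {μ : lp (fun _ : I => X) ∞} {a : lp (fun _ : I => A) ∞} {z : 𝕜}
    (h : Tendsto (fun i => e (a i) (μ i)) (U : Filter I) (𝓝 z)) : limPairing e U μ a = z :=
  tendsto_nhds_unique (tendsto_limPairing e U μ a) h

theorem norm_limPairing_le (μ : lp (fun _ : I => X) ∞) (a : lp (fun _ : I => A) ∞) :
    ‖limPairing e U μ a‖ ≤ ‖μ‖ * ‖a‖ :=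
  le_of_tendsto (tendsto_limPairing e U μ a).norm
    (Eventually.of_forall fun i => norm_pairing_le e μ a i)

/-- `limPairing` as a bounded bilinear map on bounded families. -/
def limPairingCLM : lp (fun _ : I => X) ∞ →L[𝕜] lp (fun _ : I => A) ∞ →L[𝕜] 𝕜 :=
  LinearMap.mkContinuous₂
    (LinearMap.mk₂ 𝕜 (limPairing e U)
      (fun μ ν a => limPairing_eq e U (by
        simpa using (tendsto_limPairing e U μ a).add (tendsto_limPairing e U ν a)))
      (fun c μ a => limPairing_eq e U (by
        simpa using (tendsto_limPairing e U μ a).const_mul c))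
      (fun μ a b => limPairing_eq e U (by
        simpa using (tendsto_limPairing e U μ a).add (tendsto_limPairing e U μ b)))
      (fun c μ a => limPairing_eq e U (by
        simpa using (tendsto_limPairing e U μ a).const_mul c)))
    1 (fun μ a => by simpa using norm_limPairing_le e U μ a)

theorem limPairing_eq_zero_right (μ : lp (fun _ : I => X) ∞) {a : lp (fun _ : I => A) ∞}
    (ha : a ∈ nullFamilies 𝕜 U A) : limPairing e U μ a = 0 := by
  refine limPairing_eq e U (squeeze_zero_norm (a := fun i => ‖a i‖ * ‖μ‖) (fun i => ?_) ?_)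
  · have h1 : ‖μ i‖ ≤ ‖μ‖ := lp.norm_apply_le_norm ENNReal.top_ne_zero μ i
    calc ‖e (a i) (μ i)‖ ≤ ‖e (a i)‖ * ‖μ i‖ := (e (a i)).le_opNorm _
      _ ≤ ‖a i‖ * ‖μ‖ := by rw [e.norm_map]; gcongr
  · simpa using ((mem_nullFamilies 𝕜 U a).1 ha).mul_const ‖μ‖

theorem limPairing_eq_zero_left {μ : lp (fun _ : I => X) ∞} (hμ : μ ∈ nullFamilies 𝕜 U X)
    (a : lp (fun _ : I => A) ∞) : limPairing e U μ a = 0 := by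
  refine limPairing_eq e U (squeeze_zero_norm (a := fun i => ‖a‖ * ‖μ i‖) (fun i => ?_) ?_)
  · have h1 : ‖a i‖ ≤ ‖a‖ := lp.norm_apply_le_norm ENNReal.top_ne_zero a i
    calc ‖e (a i) (μ i)‖ ≤ ‖e (a i)‖ * ‖μ i‖ := (e (a i)).le_opNorm _
      _ ≤ ‖a‖ * ‖μ i‖ := by rw [e.norm_map]; gcongr
  · simpa using ((mem_nullFamilies 𝕜 U μ).1 hμ).const_mul ‖a‖

/-- The functional on `(A)_U` given by a bounded family in `X`. -/
def familyFunctional (μ : lp (fun _ : I => X) ∞) : StrongDual 𝕜 (Ultrapower 𝕜 U A) :=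
  (nullFamilies 𝕜 U A).liftQL (limPairingCLM e U μ)
    fun _ ha => limPairing_eq_zero_right e U μ ha

theorem familyFunctional_mk (μ : lp (fun _ : I => X) ∞) (a : lp (fun _ : I => A) ∞) :
    familyFunctional e U μ (Ultrapower.mk 𝕜 U a) = limPairing e U μ a := rfl

/-- The canonical map `(X)_U → (A)_U'` given by `⟨(μ_i), (a_i)⟩ = lim_{i → U} ⟨a_i, μ_i⟩`, through
which `(X)_U` is identified with a subspace of `(A)_U'`. -/
def predualEmbedding : Ultrapower 𝕜 U X →ₗ[𝕜] StrongDual 𝕜 (Ultrapower 𝕜 U A) :=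
  (nullFamilies 𝕜 U X).liftQ
    { toFun := familyFunctional e U
      map_add' := fun μ ν => by
        refine ContinuousLinearMap.ext ?_
        rintro ⟨a⟩
        exact congrArg (fun T => T a) (map_add (limPairingCLM e U) μ ν)
      map_smul' := fun c μ => by
        refine ContinuousLinearMap.ext ?_
        rintro ⟨a⟩
        exact congrArg (fun T => T a) (map_smul (limPairingCLM e U) c μ) }
    fun μ hμ => by
      refine ContinuousLinearMap.ext ?_
      rintro ⟨a⟩
      exact limPairing_eq_zero_left e U hμ a

theorem predualEmbedding_mk (μ : lp (fun _ : I => X) ∞) (a : lp (fun _ : I => A) ∞) :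
    Tendsto (fun i => e (a i) (μ i)) (U : Filter I)
      (𝓝 (predualEmbedding e U (Ultrapower.mk 𝕜 U μ) (Ultrapower.mk 𝕜 U a))) :=
  tendsto_limPairing e U μ a

end DualBanachAlgebra

end

/-! Failure of Arens regularity is a double-limit phenomenon. If the two Arens products differ at
`μ`, with values `α ≠ β`, there are bounded `a i`, `b j` with `⟨μ, a i * b j⟩` close to `α` for `i ≤
j` and to `β` for `i > j` (`exists_approximatesArray_of_not_arensRegular`). Only finite corners of
this array are kept: the functional may change with the corner and the error, while the norm bound
`R` may not.

In this form the property is local. Goldstine's theorem carries it from a bidual to the algebra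
below with the same `R` (`ApproximatesArray.of_bidual`), hence from any even dual down to `A`. Since
`A' = X''`, it also lets the functional be taken in the predual
(`ApproximatesArray.exists_predual`).

An ultrapower glues ever larger corners with errors tending to zero into one exact infinite array,
attained by an element of `(X)_U` (`ApproximatesArray.exists_ultrapower`). Its two iterated limits
are `α` and `β`, which weak almost periodicity forces to be equal
(`eq_of_mem_WAP_of_triangularArray`). -/

section DoubleLimits

/-! ### Goldstine's theorem and finite corners of arrays -/

variable {𝕜 : Type} [RCLike 𝕜]

/-- Goldstine's theorem for finitely many functionals. -/
theorem exists_norm_le_forall_norm_sub_lt {E : Type*} [NormedAddCommGroup E] [NormedSpace 𝕜 E]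
    {ι : Type*} [Fintype ι] (Φ : StrongDual 𝕜 (StrongDual 𝕜 E)) {R : ℝ} (hR : 0 < R)
    (hΦ : ‖Φ‖ ≤ R) (f : ι → StrongDual 𝕜 E) {δ : ℝ} (hδ : 0 < δ) :
    ∃ x : E, ‖x‖ ≤ R ∧ ∀ k, ‖f k x - Φ (f k)‖ < δ := by
  classical
  let T : E →L[𝕜] (ι → 𝕜) := ContinuousLinearMap.pi f
  let p : ι → 𝕜 := fun k => Φ (f k)
  have hp : p ∈ closure (T '' Metric.closedBall 0 R) := by
    by_contra hp
    have hconv : Convex ℝ (closure (T '' Metric.closedBall 0 R)) := by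
      let _ : NormedSpace ℝ E := NormedSpace.restrictScalars ℝ 𝕜 E
      have : IsScalarTower ℝ 𝕜 E := RestrictScalars.isScalarTower ℝ 𝕜 E
      exact ((convex_closedBall (0 : E) R).linear_image (T.restrictScalars ℝ).toLinearMap).closure
    obtain ⟨g, u, hg, hu⟩ := RCLike.geometric_hahn_banach_closed_point (𝕜 := 𝕜) hconv
      isClosed_closure hp
    -- The separating functional `g` on the finite product pulls back along `T` to a combination `h`
    -- of the `f k`, and `g p = Φ h`; so `h` is bounded by `u / R` although `re (Φ h)` exceeds `u`.
    let h : StrongDual 𝕜 E := ∑ k, g (Pi.single k 1) • f k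
    have hgy (y : ι → 𝕜) : g y = ∑ k, g (Pi.single k 1) * y k := by
      conv_lhs => rw [pi_eq_sum_univ' y]
      simp [map_sum, mul_comm]
    have hhx (x : E) : g (T x) = h x := by
      rw [hgy]
      simp [h, T]
    have hhp : g p = Φ h := by
      rw [hgy]
      simp [h, p]
    have hre (x : E) (hx : ‖x‖ ≤ R) : RCLike.re (h x) < u := by
      rw [← hhx]
      exact hg _ (subset_closure ⟨x, by simpa using hx, rfl⟩)
    have hu0 : 0 < u := by simpa using hre 0 (by simpa using hR.le)
    have hnorm : ‖h‖ ≤ u / R := by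
      refine ContinuousLinearMap.opNorm_le_bound _ (by positivity) fun x => ?_
      rcases eq_or_ne x 0 with rfl | hx
      · simp
      have hx0 : 0 < ‖x‖ := norm_pos_iff.2 hx
      obtain ⟨c, hc, hcx⟩ := RCLike.exists_norm_eq_mul_self (h x)
      -- Rotate and scale `x` to norm `R` so that the value of `h` becomes `‖h x‖ * R / ‖x‖`.
      have h1 := hre ((c * ((R / ‖x‖ : ℝ) : 𝕜)) • x) (by
        rw [norm_smul, norm_mul, hc, RCLike.norm_ofReal, abs_of_pos (by positivity)]
        field_simp
        exact le_rfl)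
      rw [map_smul, smul_eq_mul, mul_right_comm, ← hcx, ← RCLike.ofReal_mul, RCLike.ofReal_re] at h1
      rw [div_mul_eq_mul_div, le_div_iff₀ hR]
      rw [mul_div_assoc', div_lt_iff₀ hx0] at h1
      exact h1.le
    have h2 : ‖Φ h‖ ≤ u := calc
      ‖Φ h‖ ≤ ‖Φ‖ * ‖h‖ := Φ.le_opNorm h
      _ ≤ R * (u / R) := by gcongr
      _ = u := by field_simp
    rw [hhp] at hu
    linarith [RCLike.re_le_norm (Φ h)]
  obtain ⟨_, ⟨x, hx, rfl⟩, hxp⟩ := Metric.mem_closure_iff.1 hp δ hδ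
  refine ⟨x, by simpa using hx, fun k => ?_⟩
  rw [dist_comm, dist_eq_norm] at hxp
  exact (norm_le_pi_norm (T x - p) k).trans_lt hxp

/-- Every finite corner of the double array `t` is, up to an arbitrarily small error, of the form
`⟨μ, a i * b j⟩` with `μ`, `a i`, `b j` of norm at most `R`. -/
def ApproximatesArray (𝕜 : Type) [RCLike 𝕜] (B : Type u) [NonUnitalNormedRing B] [NormedSpace 𝕜 B]
    (R : ℝ) (t : ℕ → ℕ → 𝕜) : Prop :=
  ∀ (N : ℕ) (δ : ℝ), 0 < δ → ∃ (μ : StrongDual 𝕜 B) (a b : ℕ → B), ‖μ‖ ≤ R ∧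
    (∀ i, ‖a i‖ ≤ R) ∧ (∀ j, ‖b j‖ ≤ R) ∧ ∀ i < N, ∀ j < N, ‖μ (a i * b j) - t i j‖ < δ

/-- The array with entries `α` on and above the diagonal and `β` below it. -/
def triangularArray (α β : 𝕜) (i j : ℕ) : 𝕜 := if i ≤ j then α else β

/-! ### Arens products and double limits -/

section

variable {B : Type u} [NonUnitalNormedRing B] [NormedSpace 𝕜 B]
  [IsScalarTower 𝕜 B B] [SMulCommClass 𝕜 B B]

/-- The order of choice follows `⟨Φ □ Ψ, μ⟩ = ⟨Φ, Ψ · μ⟩`: `μ` replaces `l` on the products, then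
each `a i` replaces `Φ i` on the `Ψ j · μ`, then each `b j` replaces `Ψ j` on the `μ · a i`. These
three errors and the given one account for `δ / 4`. -/
theorem ApproximatesArray.of_bidual {R : ℝ} (hR : 0 < R) {t : ℕ → ℕ → 𝕜}
    (h : ApproximatesArray 𝕜 (Bidual 𝕜 B) R t) : ApproximatesArray 𝕜 B R t := by
  intro N δ hδ
  obtain ⟨l, Φ, Ψ, hl, hΦ, hΨ, hlt⟩ := h N (δ / 4) (by positivity)
  obtain ⟨μ, hμ, hμl⟩ := exists_norm_le_forall_norm_sub_lt (𝕜 := 𝕜) (E := StrongDual 𝕜 B) l hR hl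
    (fun k : Fin N × Fin N => arensFirst 𝕜 B (Φ k.1) (Ψ k.2)) (δ := δ / 4) (by positivity)
  choose a ha haΦ using fun i => exists_norm_le_forall_norm_sub_lt (𝕜 := 𝕜) (E := B) (Φ i) hR (hΦ i)
    (fun j : Fin N => bidualLeft 𝕜 B (Ψ j) μ) (δ := δ / 4) (by positivity)
  choose b hb hbΨ using fun j => exists_norm_le_forall_norm_sub_lt (𝕜 := 𝕜) (E := B) (Ψ j) hR (hΨ j)
    (fun i : Fin N => dualRight 𝕜 B μ (a i)) (δ := δ / 4) (by positivity)
  refine ⟨μ, a, b, hμ, ha, hb, fun i hi j hj => ?_⟩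
  have h1 := hlt i hi j hj
  have h2 : ‖arensFirst 𝕜 B (Φ i) (Ψ j) μ - l (Φ i * Ψ j)‖ < δ / 4 := hμl (⟨i, hi⟩, ⟨j, hj⟩)
  have h3 : ‖bidualLeft 𝕜 B (Ψ j) μ (a i) - arensFirst 𝕜 B (Φ i) (Ψ j) μ‖ < δ / 4 :=
    haΦ i ⟨j, hj⟩
  have h4 : ‖μ (a i * b j) - bidualLeft 𝕜 B (Ψ j) μ (a i)‖ < δ / 4 := hbΨ j ⟨i, hi⟩
  have h5 := norm_sub_le_norm_sub_add_norm_sub (μ (a i * b j)) (bidualLeft 𝕜 B (Ψ j) μ (a i))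
    (arensFirst 𝕜 B (Φ i) (Ψ j) μ)
  have h6 := norm_sub_le_norm_sub_add_norm_sub (arensFirst 𝕜 B (Φ i) (Ψ j) μ) (l (Φ i * Ψ j))
    (t i j)
  have h7 := norm_sub_le_norm_sub_add_norm_sub (μ (a i * b j)) (arensFirst 𝕜 B (Φ i) (Ψ j) μ)
    (t i j)
  linarith

theorem exists_approximatesArray_of_not_arensRegular (h : ¬ ArensRegular 𝕜 B) :
    ∃ (R : ℝ) (α β : 𝕜), 0 < R ∧ α ≠ β ∧ ApproximatesArray 𝕜 B R (triangularArray α β) := by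
  obtain ⟨Φ, Ψ, hne⟩ : ∃ Φ Ψ, arensFirst 𝕜 B Φ Ψ ≠ arensSecond 𝕜 B Φ Ψ := by
    simpa [ArensRegular] using h
  obtain ⟨μ, hμ⟩ := DFunLike.ne_iff.1 hne
  let R : ℝ := ‖Φ‖ + ‖Ψ‖ + ‖μ‖ + 1
  have hR : 0 < R := by positivity
  have hΦR : ‖Φ‖ ≤ R := by dsimp only [R]; linarith [norm_nonneg Φ, norm_nonneg Ψ, norm_nonneg μ]
  have hΨR : ‖Ψ‖ ≤ R := by dsimp only [R]; linarith [norm_nonneg Φ, norm_nonneg Ψ, norm_nonneg μ]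
  have hμR : ‖μ‖ ≤ R := by dsimp only [R]; linarith [norm_nonneg Φ, norm_nonneg Ψ, norm_nonneg μ]
  set α := arensFirst 𝕜 B Φ Ψ μ with hα
  set β := arensSecond 𝕜 B Φ Ψ μ with hβ
  refine ⟨R, α, β, hR, hμ, fun N δ hδ => ?_⟩
  -- The induction also records `⟨Ψ, μ · a i⟩ ≈ α` and `⟨Φ, b j · μ⟩ ≈ β`, so later terms only have
  -- to approximate `Ψ` and `Φ` at these functionals. Errors do not accumulate, as `x` and `y` meet
  -- the invariants directly from `Φ` and `Ψ`.
  have key : ∃ a b : ℕ → B, (∀ i, ‖a i‖ ≤ R) ∧ (∀ j, ‖b j‖ ≤ R) ∧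
      (∀ i < N, ‖Ψ (dualRight 𝕜 B μ (a i)) - α‖ < δ / 2) ∧
      (∀ j < N, ‖Φ (dualLeft 𝕜 B μ (b j)) - β‖ < δ / 2) ∧
      ∀ i < N, ∀ j < N, ‖μ (a i * b j) - triangularArray α β i j‖ < δ := by
    induction N with
    | zero => exact ⟨0, 0, by simp [hR.le], by simp [hR.le], by simp, by simp, by simp⟩
    | succ N ih =>
      obtain ⟨a, b, ha, hb, haα, hbβ, hab⟩ := ih
      obtain ⟨x, hx, hxΦ⟩ := exists_norm_le_forall_norm_sub_lt Φ hR hΦR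
        (fun k : Option (Fin N) => k.elim (bidualLeft 𝕜 B Ψ μ) fun j => dualLeft 𝕜 B μ (b j))
        (half_pos hδ)
      have hxα : ‖Ψ (dualRight 𝕜 B μ x) - α‖ < δ / 2 := hxΦ none
      have hxb (j : ℕ) (hj : j < N) : ‖μ (x * b j) - β‖ < δ := by
        have h1 : ‖μ (x * b j) - Φ (dualLeft 𝕜 B μ (b j))‖ < δ / 2 := hxΦ (some ⟨j, hj⟩)
        linarith [norm_sub_le_norm_sub_add_norm_sub (μ (x * b j)) (Φ (dualLeft 𝕜 B μ (b j))) β,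
          hbβ j hj]
      -- Choosing `y` after `x` puts `α` on the diagonal.
      obtain ⟨y, hy, hyΨ⟩ := exists_norm_le_forall_norm_sub_lt Ψ hR hΨR
        (fun k : Option (Option (Fin N)) => k.elim (bidualRight 𝕜 B Φ μ) fun k =>
          k.elim (dualRight 𝕜 B μ x) fun i => dualRight 𝕜 B μ (a i)) (half_pos hδ)
      have hyβ : ‖Φ (dualLeft 𝕜 B μ y) - β‖ < δ / 2 := hyΨ none
      have hay (z : B) (hz : ‖Ψ (dualRight 𝕜 B μ z) - α‖ < δ / 2)
          (h1 : ‖μ (z * y) - Ψ (dualRight 𝕜 B μ z)‖ < δ / 2) : ‖μ (z * y) - α‖ < δ := by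
        linarith [norm_sub_le_norm_sub_add_norm_sub (μ (z * y)) (Ψ (dualRight 𝕜 B μ z)) α]
      have hxy : ‖μ (x * y) - α‖ < δ := hay x hxα (hyΨ (some none))
      refine ⟨Function.update a N x, Function.update b N y, fun i => ?_, fun j => ?_,
        fun i hi => ?_, fun j hj => ?_, fun i hi j hj => ?_⟩
      · rcases eq_or_ne i N with rfl | hne <;> simp [*]
      · rcases eq_or_ne j N with rfl | hne <;> simp [*]
      · rcases Nat.lt_succ_iff_lt_or_eq.1 hi with hi | rfl
        · simpa [hi.ne] using haα i hi
        · simpa using hxα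
      · rcases Nat.lt_succ_iff_lt_or_eq.1 hj with hj | rfl
        · simpa [hj.ne] using hbβ j hj
        · simpa using hyβ
      · rcases Nat.lt_succ_iff_lt_or_eq.1 hi with hi | rfl <;>
          rcases Nat.lt_succ_iff_lt_or_eq.1 hj with hj | rfl
        · simpa [hi.ne, hj.ne] using hab i hi j hj
        · simpa [hi.ne, triangularArray, hi.le] using
            hay (a i) (haα i hi) (hyΨ (some (some ⟨i, hi⟩)))
        · simpa [hj.ne, triangularArray, hj.not_ge] using hxb j hj
        · simpa [triangularArray] using hxy
  obtain ⟨a, b, ha, hb, -, -, hab⟩ := key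
  exact ⟨μ, a, b, hμR, ha, hb, hab⟩

/-- The easy half of Grothendieck's double limit criterion. -/
theorem eq_of_mem_WAP_of_triangularArray {μ : StrongDual 𝕜 B} (hμ : μ ∈ WAP 𝕜 B) {R : ℝ}
    {a b : ℕ → B} (ha : ∀ i, ‖a i‖ ≤ R) (hb : ∀ j, ‖b j‖ ≤ 1) {α β : 𝕜}
    (h : ∀ i j, μ (a i * b j) = triangularArray α β i j) : α = β := by
  let V : Ultrafilter ℕ := hyperfilter ℕ
  have hV : (V : Filter ℕ) ≤ atTop := Nat.hyperfilter_le_atTop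
  -- `f` is a weak limit of the `b j · μ`, and `Φ` below a weak-star limit of the `a i` in the
  -- bidual. Then `⟨Φ, f⟩` computes both iterated limits: `β` through the `b j`, `α` through the `a
  -- i`.
  obtain ⟨f, -, hf⟩ := (show IsCompact _ from hμ).ultrafilter_le_nhds'
    (V.map fun j => toWeakSpace 𝕜 (StrongDual 𝕜 B) (dualLeft 𝕜 B μ (b j)))
    (Filter.mem_map.2 (Filter.univ_mem' fun j =>
      subset_closure ⟨b j, by simpa using hb j, rfl⟩))
  obtain ⟨Φ, -, hΦ⟩ := (WeakDual.isCompact_closedBall (𝕜 := 𝕜) (E := StrongDual 𝕜 B) 0 R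
    ).ultrafilter_le_nhds'
    (V.map fun i => StrongDual.toWeakDual (NormedSpace.inclusionInDoubleDual 𝕜 B (a i)))
    (Filter.mem_map.2 (Filter.univ_mem' fun i => by
      simpa using (NormedSpace.double_dual_bound 𝕜 B (a i)).trans (ha i)))
  have hfΘ (Θ : StrongDual 𝕜 (StrongDual 𝕜 B)) :
      Tendsto (fun j => Θ (dualLeft 𝕜 B μ (b j))) V (𝓝 (Θ ((toWeakSpace 𝕜 _).symm f))) :=
    ((WeakBilin.eval_continuous (topDualPairing 𝕜 (StrongDual 𝕜 B)).flip Θ).tendsto f).comp hf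
  have hΦg (g : StrongDual 𝕜 B) : Tendsto (fun i => g (a i)) V (𝓝 (Φ g)) :=
    ((WeakDual.eval_continuous g).tendsto Φ).comp hΦ
  have h1 (j : ℕ) : Φ (dualLeft 𝕜 B μ (b j)) = β := by
    refine tendsto_nhds_unique (hΦg _) (tendsto_const_nhds.congr' ?_)
    filter_upwards [hV (eventually_gt_atTop j)] with i hi
    rw [dualLeft_apply, h, triangularArray, if_neg (not_le.2 hi)]
  have h2 (i : ℕ) : (toWeakSpace 𝕜 (StrongDual 𝕜 B)).symm f (a i) = α := by
    refine tendsto_nhds_unique (hfΘ (NormedSpace.inclusionInDoubleDual 𝕜 B (a i)))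
      (tendsto_const_nhds.congr' ?_)
    filter_upwards [hV (eventually_ge_atTop i)] with j hj
    rw [NormedSpace.dual_def, dualLeft_apply, h, triangularArray, if_pos hj]
  have h3 : Φ ((toWeakSpace 𝕜 (StrongDual 𝕜 B)).symm f) = β :=
    tendsto_nhds_unique (hfΘ (WeakDual.toStrongDual Φ))
      (tendsto_const_nhds.congr fun j => (h1 j).symm)
  have h4 : Φ ((toWeakSpace 𝕜 (StrongDual 𝕜 B)).symm f) = α :=
    tendsto_nhds_unique (hΦg _) (tendsto_const_nhds.congr fun i => (h2 i).symm)
  exact h4.symm.trans h3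

end

theorem ApproximatesArray.of_evenDual {R : ℝ} (hR : 0 < R) {t : ℕ → ℕ → 𝕜} (B : BanachAlg.{u} 𝕜)
    (n : ℕ) (h : ApproximatesArray 𝕜 (evenDual B n).carrier R t) :
    ApproximatesArray 𝕜 B.carrier R t := by
  induction n with
  | zero => exact h
  | succ n ih => exact ih (ApproximatesArray.of_bidual (B := (evenDual B n).carrier) hR h)

/-! ### Preduals and ultrapowers -/

section Predual

variable {A : Type u} [NonUnitalNormedRing A] [NormedSpace 𝕜 A]
  {X : Type u} [NormedAddCommGroup X] [NormedSpace 𝕜 X]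

/-- Through `e`, a functional on `A` is an element of `X''`, which Goldstine's theorem approximates
by some `x : X` on the finitely many products `a i * b j`. -/
theorem ApproximatesArray.exists_predual (e : A ≃ₗᵢ[𝕜] StrongDual 𝕜 X) {R : ℝ} (hR : 0 < R)
    {t : ℕ → ℕ → 𝕜} (h : ApproximatesArray 𝕜 A R t) (N : ℕ) {δ : ℝ} (hδ : 0 < δ) :
    ∃ (x : X) (a b : ℕ → A), ‖x‖ ≤ R ∧ (∀ i, ‖a i‖ ≤ R) ∧ (∀ j, ‖b j‖ ≤ R) ∧
      ∀ i < N, ∀ j < N, ‖e (a i * b j) x - t i j‖ < δ := by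
  obtain ⟨μ, a, b, hμ, ha, hb, hab⟩ := h N (δ / 2) (half_pos hδ)
  let Φ : StrongDual 𝕜 (StrongDual 𝕜 X) := μ.comp (e.symm.toContinuousLinearEquiv : _ →L[𝕜] A)
  have hΦ : ‖Φ‖ ≤ R := ContinuousLinearMap.opNorm_le_bound _ hR.le fun f => by
    simpa [Φ] using μ.le_of_opNorm_le hμ (e.symm f)
  obtain ⟨x, hx, hxΦ⟩ := exists_norm_le_forall_norm_sub_lt Φ hR hΦ
    (fun k : Fin N × Fin N => e (a k.1 * b k.2)) (half_pos hδ)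
  refine ⟨x, a, b, hx, ha, hb, fun i hi j hj => ?_⟩
  have h1 : ‖e (a i * b j) x - μ (a i * b j)‖ < δ / 2 := by
    simpa [Φ] using hxΦ (⟨i, hi⟩, ⟨j, hj⟩)
  linarith [norm_sub_le_norm_sub_add_norm_sub (e (a i * b j) x) (μ (a i * b j)) (t i j),
    hab i hi j hj]

/-- In an ultrapower over `ℕ`, an approximated array is attained by a functional coming from the
ultrapower of the predual. -/
theorem ApproximatesArray.exists_ultrapower (e : A ≃ₗᵢ[𝕜] StrongDual 𝕜 X) {R : ℝ} (hR : 0 < R)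
    {t : ℕ → ℕ → 𝕜} (h : ApproximatesArray 𝕜 A R t) {I : Type v} (U : Ultrafilter I)
    {φ : I → ℕ} (hφ : Tendsto φ U atTop) :
    ∃ (μ : Ultrapower 𝕜 U X) (a b : ℕ → Ultrapower 𝕜 U A), (∀ i, ‖a i‖ ≤ R) ∧
      (∀ j, ‖b j‖ ≤ R) ∧ ∀ i j, predualEmbedding e U μ (a i * b j) = t i j := by
  -- Stage `n` handles the `n × n` corner with error `1 / (n + 1)`; coordinate `k` of the ultrapower
  -- uses stage `φ k`.
  choose x a b hx ha hb hab using fun n : ℕ =>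
    h.exists_predual e hR n (δ := 1 / ((n : ℝ) + 1)) (by positivity)
  let x' : lp (fun _ : I => X) ∞ := ⟨fun k => x (φ k), memℓp_infty ⟨R, by
    rintro _ ⟨k, rfl⟩; exact hx _⟩⟩
  let a' (i : ℕ) : lp (fun _ : I => A) ∞ := ⟨fun k => a (φ k) i, memℓp_infty ⟨R, by
    rintro _ ⟨k, rfl⟩; exact ha _ i⟩⟩
  let b' (j : ℕ) : lp (fun _ : I => A) ∞ := ⟨fun k => b (φ k) j, memℓp_infty ⟨R, by
    rintro _ ⟨k, rfl⟩; exact hb _ j⟩⟩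
  refine ⟨Ultrapower.mk 𝕜 U x', fun i => Ultrapower.mk 𝕜 U (a' i),
    fun j => Ultrapower.mk 𝕜 U (b' j), fun i => ?_, fun j => ?_, fun i j => ?_⟩
  · exact (Submodule.Quotient.norm_mk_le _ (a' i)).trans
      (lp.norm_le_of_forall_le hR.le fun k => ha _ i)
  · exact (Submodule.Quotient.norm_mk_le _ (b' j)).trans
      (lp.norm_le_of_forall_le hR.le fun k => hb _ j)
  · rw [← Ultrapower.mk_mul]
    refine tendsto_nhds_unique (predualEmbedding_mk e U x' (a' i * b' j)) ?_
    rw [tendsto_iff_norm_sub_tendsto_zero]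
    refine squeeze_zero' (Eventually.of_forall fun _ => norm_nonneg _) ?_
      (tendsto_one_div_add_atTop_nhds_zero_nat.comp hφ)
    -- Entry `(i, j)` is controlled once `φ k > max i j`.
    filter_upwards [hφ (eventually_gt_atTop (max i j))] with k hk
    exact (hab (φ k) i ((le_max_left _ _).trans_lt hk) j ((le_max_right _ _).trans_lt hk)).le

end Predual

end DoubleLimits

theorem mainTheorem8 {𝕜 : Type} [RCLike 𝕜]
    {A : Type u} [NonUnitalNormedRing A] [NormedSpace 𝕜 A] [IsScalarTower 𝕜 A A]
    [SMulCommClass 𝕜 A A] [CompleteSpace A]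
    {X : Type u} [NormedAddCommGroup X] [NormedSpace 𝕜 X] [CompleteSpace X]
    (e : A ≃ₗᵢ[𝕜] StrongDual 𝕜 X) (hA : IsDualBanachAlgebra e)
    (hWAP : ∀ (I : Type u) (U : Ultrafilter I), (∀ i : I, U ≠ pure i) →
      Set.range (predualEmbedding e U) ⊆ WAP 𝕜 (Ultrapower 𝕜 U A)) :
    ∀ n : ℕ, ArensRegular 𝕜 (evenDual (BanachAlg.mk (𝕜 := 𝕜) A) n).carrier := by
  intro n
  by_contra hn
  obtain ⟨R, α, β, hR, hne, hpat⟩ := exists_approximatesArray_of_not_arensRegular hn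
  have hpatA : ApproximatesArray 𝕜 A R (triangularArray α β) :=
    ApproximatesArray.of_evenDual hR (BanachAlg.mk (𝕜 := 𝕜) A) n hpat
  -- `ULift` moves `ℕ` to the universe of the index sets in `hWAP`.
  let U : Ultrafilter (ULift.{u} ℕ) := hyperfilter (ULift.{u} ℕ)
  have hU (i : ULift.{u} ℕ) : U ≠ pure i := fun hi => by
    have h1 : ({i} : Set (ULift.{u} ℕ)) ∉ hyperfilter (ULift.{u} ℕ) :=
      (Set.finite_singleton i).notMem_hyperfilter
    refine h1 ?_
    change ({i} : Set (ULift.{u} ℕ)) ∈ U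
    rw [hi]
    exact Set.mem_singleton i
  have hφ : Tendsto (ULift.down : ULift.{u} ℕ → ℕ) U atTop := by
    rw [← Nat.cofinite_eq_atTop]
    exact ULift.down_injective.tendsto_cofinite.mono_left hyperfilter_le_cofinite
  obtain ⟨μ, a, b, ha, hb, hab⟩ := hpatA.exists_ultrapower e hR U hφ
  have hR0 : (R : 𝕜) ≠ 0 := RCLike.ofReal_ne_zero.2 hR.ne'
  -- Weak compactness concerns the unit ball, so the `b j` are divided by `R`; this scales both `α`
  -- and `β` by `R⁻¹`.
  refine hne (mul_left_cancel₀ (inv_ne_zero hR0) (eq_of_mem_WAP_of_triangularArray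
    (hWAP _ U hU ⟨μ, rfl⟩) ha (b := fun j => (R : 𝕜)⁻¹ • b j) (fun j => ?_) fun i j => ?_))
  · rw [norm_smul, norm_inv, RCLike.norm_ofReal, abs_of_pos hR, inv_mul_le_one₀ hR]
    exact hb j
  · rw [mul_smul_comm, map_smul, hab, smul_eq_mul, triangularArray, triangularArray, mul_ite]
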